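/- **Theorem 2 (Examples without sharp transition).** For a real $m\times n$ matrix $\mathbf A$ with columns $\mathbf a_1,\dots,\mathbf a_n$, let $\lambda_1\ge\lambda_2\ge\dots\ge\lambda_n$ be the eigenvalues of $\mathbf A^\top\mathbf A$. For $S\subseteq\{1,\dots,n\}$ let $\mathrm{Er}_{\mathbf A}(S)=\|\mathbf A-\mathbf P_S\mathbf A\|_F^2$, where $\mathbf P_S$ is the orthogonal projection onto $\mathrm{span}\{\mathbf a_i: i\in S\}$, and let $\mathrm{OPT}_k=\min_{\mathbf B:\,\mathrm{rank}(\mathbf B)=k}\|\mathbf A-\mathbf B\|_F^2$. Let $S\sim k\text{-}\mathrm{DPP}(\mathbf A^\top\mathbf A)$ be the random subset of $\{1,\dots,n\}$ of size $k$ with $\Pr(S)\propto\det\big((\mathbf A^\top\mathbf A)_{S,S}\big)$, the principal submatrix being indexed by $S$. There is an absolute constant $c>0$ such that for all $m,n$, every $\mathbf A\in\mathbb R^{m\times n}$ and all $0<c_1\le c_2$, with $\gamma=c_2/c_1$: 1. (polynomial spectral decay) if $p>1$ and $c_1 i^{-p}\le\lambda_i\le c_2 i^{-p}$ for all $i\in\{1,\dots,n\}$,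 then for every $0\le k<n$ the distribution $k\text{-}\mathrm{DPP}(\mathbf A^\top\mathbf A)$ is well defined, $\mathrm{OPT}_k>0$, and $$\frac{\mathbb E[\mathrm{Er}_{\mathbf A}(S)]}{\mathrm{OPT}_k}\le c\,\gamma\,p;$$ 2. (exponential spectral decay) if $\delta\in(0,1)$ and $c_1(1-\delta)^i\le\lambda_i\le c_2(1-\delta)^i$ for all $i\in\{1,\dots,n\}$, then for every $0\le k<n$ the distribution $k\text{-}\mathrm{DPP}(\mathbf A^\top\mathbf A)$ is well defined, $\mathrm{OPT}_k>0$, and $$\frac{\mathbb E[\mathrm{Er}_{\mathbf A}(S)]}{\mathrm{OPT}_k}\le c\,\gamma\,(1+\delta k).$$ -/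

import Mathlib

open scoped Matrix

noncomputable section

namespace CSSP

theorem isHermitian_gram {m n : ℕ} (A : Matrix (Fin m) (Fin n) ℝ) : (Aᵀ * A).IsHermitian := by
  rw [← Matrix.conjTranspose_eq_transpose_of_trivial]
  exact Matrix.isHermitian_conjTranspose_mul_self A

/-- The eigenvalues `λ₁ ≥ λ₂ ≥ … ≥ λₙ` of the Gram matrix `Aᵀ A`, with multiplicity and in
decreasing order; `gramEigenvalue A i` for `i : Fin n` is `λ_{i+1}`. -/
def gramEigenvalue {m n : ℕ} (A : Matrix (Fin m) (Fin n) ℝ) (i : Fin n) : ℝ :=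
  (isHermitian_gram A).eigenvalues₀ (Fin.cast (Fintype.card_fin n).symm i)

/-- The span of the columns of `A` with index in `S`, inside Euclidean space. -/
def colSpan {m n : ℕ} (A : Matrix (Fin m) (Fin n) ℝ) (S : Finset (Fin n)) :
    Submodule ℝ (EuclideanSpace ℝ (Fin m)) :=
  Submodule.span ℝ ((fun j => WithLp.toLp 2 (A.col j)) '' (S : Set (Fin n)))

/-- The matrix `P_S` of the orthogonal projection onto the span of the columns in `S`. -/
def projMatrix {m n : ℕ} (A : Matrix (Fin m) (Fin n) ℝ) (S : Finset (Fin n)) :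
    Matrix (Fin m) (Fin m) ℝ :=
  Matrix.toEuclideanLin.symm
    ((colSpan A S).starProjection :
      EuclideanSpace ℝ (Fin m) →ₗ[ℝ] EuclideanSpace ℝ (Fin m))

/-- The squared Frobenius norm. -/
def frobSq {m n : ℕ} (M : Matrix (Fin m) (Fin n) ℝ) : ℝ :=
  ∑ i, ∑ j, M i j ^ 2

/-- The subset selection error `Er_A(S) = ‖A - P_S A‖_F²`. -/
def Er {m n : ℕ} (A : Matrix (Fin m) (Fin n) ℝ) (S : Finset (Fin n)) : ℝ :=
  frobSq (A - projMatrix A S * A)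

/-- The least squared Frobenius error of an approximation of `A` by a matrix of rank `k`. -/
def OPT {m n : ℕ} (A : Matrix (Fin m) (Fin n) ℝ) (k : ℕ) : ℝ :=
  ⨅ B : {B : Matrix (Fin m) (Fin n) ℝ // B.rank = k}, frobSq (A - B.1)

/-- The principal minor `det(K_{S,S})`. -/
def principalMinor {n : ℕ} (K : Matrix (Fin n) (Fin n) ℝ) (S : Finset (Fin n)) : ℝ :=
  (K.submatrix (fun i : S => (i : Fin n)) (fun i : S => (i : Fin n))).det

/-- The normalizing constant of `k`-DPP(`K`): the sum of all principal minors of size `k`. -/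
def kDPPNormalizer {n : ℕ} (K : Matrix (Fin n) (Fin n) ℝ) (k : ℕ) : ℝ :=
  ∑ T ∈ Finset.univ.powersetCard k, principalMinor K T

/-- The probability of the set `S` under `k`-DPP(`K`), the distribution on the subsets of size `k`
with probabilities proportional to the principal minors of the p.s.d. matrix `K`. -/
def kDPPProb {n : ℕ} (K : Matrix (Fin n) (Fin n) ℝ) (k : ℕ) (S : Finset (Fin n)) : ℝ :=
  if S.card = k then principalMinor K S / kDPPNormalizer K k else 0

/-- The expectation of `f(S)` for `S ∼ k`-DPP(`K`). -/
def kDPPExpect {n : ℕ} (K : Matrix (Fin n) (Fin n) ℝ) (k : ℕ)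
    (f : Finset (Fin n) → ℝ) : ℝ :=
  ∑ S, kDPPProb K k S * f S

end CSSP

end

noncomputable section

namespace CSSP

/-! The base-times-height formula for Gram determinants turns the expected error into `(k+1)
e_{k+1}(λ) / e_k(λ)` (`kDPPExpect_Er`), and the Eckart–Young lower bound gives `OPT_k ≥ T`, where
`T` is the sum of the eigenvalues from position `k` on (`tailSum_le_OPT`). It remains to bound the
ratio by a multiple of `T`.

The basic estimate `elemSymm_succ_le` says that `e_{k+1} / e_k` is at most `(n-k)/(d+1)` times the
mean of `λ` over any `L` with `n-k+d` elements. With `d = 0` and `L` the tail it only gives the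
factor `k+1`. Adding to `L` the `d` positions before `k` improves this to order `γ(k+1)/(d+1)`,
provided that the decay profile changes by at most a factor 2 within `d` positions of `k`: the added
terms are then paid for by the tail itself (`elemSymm_succ_le_tail`). Such a `d` is of order `k/p`
for polynomial decay and `min(k, 1/δ)` for exponential decay. -/

/-! ### Inequalities between consecutive elementary symmetric polynomials. -/

/-- The elementary symmetric polynomial of degree `k` evaluated at `x`. -/
def elemSymm {ι : Type*} [Fintype ι] (x : ι → ℝ) (k : ℕ) : ℝ :=
  ∑ T ∈ Finset.univ.powersetCard k, ∏ i ∈ T, x i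

section ElemSymm

open Finset

variable {ι : Type*} [Fintype ι] [DecidableEq ι]

/-- Double counting of the pairs (set, marked element of `L`). It serves both for spectra and, with
`L = univ`, for principal minors. -/
theorem sum_powersetCard_insert (F : Finset ι → ℝ) (L : Finset ι) (k : ℕ) :
    ∑ S ∈ univ.powersetCard k, ∑ j ∈ L \ S, F (insert j S) =
      ∑ T ∈ univ.powersetCard (k + 1), (#(T ∩ L) : ℝ) * F T := by
  have h : ∀ T : Finset ι, (#(T ∩ L) : ℝ) * F T = ∑ _j ∈ T ∩ L, F T := by simp
  simp_rw [h]
  rw [sum_sigma', sum_sigma']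
  refine sum_nbij' (fun x => ⟨insert x.2 x.1, x.2⟩) (fun x => ⟨x.1.erase x.2, x.2⟩) ?_ ?_ ?_ ?_ ?_
  · rintro ⟨S, j⟩ h
    simp only [mem_sigma, mem_powersetCard_univ, mem_sdiff, mem_inter] at h ⊢
    simp [card_insert_of_notMem h.2.2, h.1, h.2.1]
  · rintro ⟨T, j⟩ h
    simp only [mem_sigma, mem_powersetCard_univ, mem_sdiff, mem_inter] at h ⊢
    simp [card_erase_of_mem h.2.1, h.1, h.2.2]
  · rintro ⟨S, j⟩ h
    simp only [mem_sigma, mem_sdiff] at h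
    simp [erase_insert h.2.2]
  · rintro ⟨T, j⟩ h
    simp only [mem_sigma, mem_inter] at h
    simp [insert_erase h.2.1]
  · rintro ⟨S, j⟩ h
    rfl

/-- Exchanging `i` for `j` in `S` is a bijection between the two families and trades the factor `x
i` for `x j`. -/
theorem sum_prod_filter_swap (x : ι → ℝ) (k : ℕ) (i j : ι) :
    (∑ S ∈ univ.powersetCard k with i ∈ S ∧ j ∉ S, ∏ a ∈ S, x a) * x j =
      (∑ S ∈ univ.powersetCard k with j ∈ S ∧ i ∉ S, ∏ a ∈ S, x a) * x i := by
  rw [sum_mul, sum_mul]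
  refine sum_nbij' (fun S => insert j (S.erase i)) (fun S => insert i (S.erase j)) ?_ ?_ ?_ ?_ ?_
  · intro S h
    simp only [mem_filter, mem_powersetCard_univ] at h ⊢
    obtain ⟨hc, hi, hj⟩ := h
    have hij : i ≠ j := fun e => hj (e ▸ hi)
    have hpos : 0 < #S := card_pos.2 ⟨i, hi⟩
    rw [card_insert_of_notMem (by simp [hj]), card_erase_of_mem hi]
    refine ⟨by omega, by simp, by simp [hij]⟩
  · intro S h
    simp only [mem_filter, mem_powersetCard_univ] at h ⊢
    obtain ⟨hc, hi, hj⟩ := h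
    have hij : j ≠ i := fun e => hj (e ▸ hi)
    have hpos : 0 < #S := card_pos.2 ⟨j, hi⟩
    rw [card_insert_of_notMem (by simp [hj]), card_erase_of_mem hi]
    refine ⟨by omega, by simp, by simp [hij]⟩
  · intro S h
    simp only [mem_filter] at h
    rw [erase_insert (by simp [h.2.2]), insert_erase h.2.1]
  · intro S h
    simp only [mem_filter] at h
    rw [erase_insert (by simp [h.2.2]), insert_erase h.2.1]
  · intro S h
    simp only [mem_filter] at h
    rw [prod_insert (by simp [h.2.2]), ← mul_prod_erase S x h.2.1]
    ring

/-- Sets weighted by their product favour large variables, so in the weighted sum the chosen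
elements of `L` dominate the unchosen ones. Symmetrizing in `i, j` and using the exchange identity
reduces each term to a square with a nonnegative weight. -/
theorem sum_prod_mul_sum_sub_nonneg {x : ι → ℝ} (hx : ∀ i, 0 < x i) (L : Finset ι) (k : ℕ) :
    0 ≤ ∑ S ∈ univ.powersetCard k, (∏ a ∈ S, x a) *
      ∑ i ∈ L ∩ S, ∑ j ∈ L \ S, (x i - x j) := by
  set a : ι → ι → ℝ := fun i j => ∑ S ∈ univ.powersetCard k with i ∈ S ∧ j ∉ S, ∏ b ∈ S, x b
    with ha
  have ha0 : ∀ i j, 0 ≤ a i j := fun i j => sum_nonneg fun S _ => prod_nonneg fun b _ => (hx b).le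
  have key : ∑ S ∈ univ.powersetCard k, (∏ a ∈ S, x a) *
      ∑ i ∈ L ∩ S, ∑ j ∈ L \ S, (x i - x j) = ∑ i ∈ L, ∑ j ∈ L, a i j * (x i - x j) := by
    have h1 : ∀ S : Finset ι, (∏ a ∈ S, x a) * ∑ i ∈ L ∩ S, ∑ j ∈ L \ S, (x i - x j) =
        ∑ i ∈ L, ∑ j ∈ L, (if i ∈ S ∧ j ∉ S then ∏ a ∈ S, x a else 0) * (x i - x j) := by
      intro S
      rw [mul_sum, ← filter_mem_eq_inter, sum_filter]
      refine sum_congr rfl fun i _ => ?_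
      by_cases hi : i ∈ S
      · simp only [hi, if_true, true_and]
        rw [mul_sum, sdiff_eq_filter, sum_filter]
        refine sum_congr rfl fun j _ => ?_
        split_ifs <;> simp
      · simp [hi]
    simp_rw [h1]
    rw [sum_comm]
    refine sum_congr rfl fun i _ => ?_
    rw [sum_comm]
    refine sum_congr rfl fun j _ => ?_
    rw [← sum_mul, ha]
    simp only [sum_filter]
  rw [key]
  have h2 : 2 * ∑ i ∈ L, ∑ j ∈ L, a i j * (x i - x j) =
      ∑ i ∈ L, ∑ j ∈ L, (a i j - a j i) * (x i - x j) := by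
    rw [two_mul]
    nth_rw 2 [sum_comm]
    rw [← sum_add_distrib]
    refine sum_congr rfl fun i _ => ?_
    rw [← sum_add_distrib]
    refine sum_congr rfl fun j _ => ?_
    ring
  have h3 : 0 ≤ ∑ i ∈ L, ∑ j ∈ L, (a i j - a j i) * (x i - x j) := by
    refine sum_nonneg fun i _ => sum_nonneg fun j _ => ?_
    have hs : a i j * x j = a j i * x i := sum_prod_filter_swap x k i j
    refine nonneg_of_mul_nonneg_right (a := x j) ?_ (hx j)
    have : x j * ((a i j - a j i) * (x i - x j)) = a j i * (x i - x j) ^ 2 := by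
      linear_combination (x i - x j) * hs
    rw [this]
    exact mul_nonneg (ha0 j i) (sq_nonneg _)
  linarith

/-- An upper bound for the ratio of consecutive elementary symmetric polynomials by the mean of
the variables in `L`. -/
theorem elemSymm_succ_le {x : ι → ℝ} (hx : ∀ i, 0 < x i) (L : Finset ι) {k d : ℕ}
    (hd : k + #L = d + Fintype.card ι) :
    ((d : ℝ) + 1) * #L * elemSymm x (k + 1) ≤
      ((Fintype.card ι : ℝ) - k) * (∑ i ∈ L, x i) * elemSymm x k := by
  have hw : ∀ S : Finset ι, 0 ≤ ∏ a ∈ S, x a := fun S => prod_nonneg fun b _ => (hx b).le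
  have hinter : ∀ S : Finset ι, #S + #L ≤ Fintype.card ι + #(S ∩ L) := fun S => by
    have := card_union_add_card_inter S L
    have := card_le_univ (S ∪ L)
    omega
  have h1 : ((d : ℝ) + 1) * elemSymm x (k + 1) ≤
      ∑ S ∈ univ.powersetCard k, (∏ a ∈ S, x a) * ∑ j ∈ L \ S, x j := by
    have e : ∑ S ∈ univ.powersetCard k, (∏ a ∈ S, x a) * ∑ j ∈ L \ S, x j =
        ∑ S ∈ univ.powersetCard k, ∑ j ∈ L \ S, ∏ a ∈ insert j S, x a := by
      refine sum_congr rfl fun S _ => ?_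
      rw [mul_sum]
      refine sum_congr rfl fun j hj => ?_
      rw [prod_insert (mem_sdiff.1 hj).2, mul_comm]
    rw [e, sum_powersetCard_insert (fun T => ∏ a ∈ T, x a), elemSymm, mul_sum]
    -- A set of size `k+1` meets `L` in at least `k + 1 + #L - n = d + 1` elements.
    refine sum_le_sum fun T hT => mul_le_mul_of_nonneg_right ?_ (hw T)
    rw [mem_powersetCard_univ] at hT
    have := hinter T
    exact_mod_cast (by omega : d + 1 ≤ #(T ∩ L))
  have h2 := sum_prod_mul_sum_sub_nonneg hx L k
  -- The double sum equals `#(L \ S) * ∑_L x - #L * ∑_{L \ S} x`, and `#(L \ S) ≤ n - k`.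
  have h3 : ∀ S ∈ univ.powersetCard k, (∏ a ∈ S, x a) *
      ∑ i ∈ L ∩ S, ∑ j ∈ L \ S, (x i - x j) ≤ (∏ a ∈ S, x a) *
        (((Fintype.card ι : ℝ) - k) * (∑ i ∈ L, x i) - #L * ∑ j ∈ L \ S, x j) := by
    intro S hS
    refine mul_le_mul_of_nonneg_left ?_ (hw S)
    rw [mem_powersetCard_univ] at hS
    have hsum := sum_inter_add_sum_sdiff L S x
    have hcard : (#(L ∩ S) : ℝ) + #(L \ S) = #L := by
      exact_mod_cast card_inter_add_card_sdiff L S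
    have hle : (#(L \ S) : ℝ) ≤ (Fintype.card ι : ℝ) - k := by
      have h := hinter S
      rw [inter_comm] at h
      have h' := card_inter_add_card_sdiff L S
      rw [le_sub_iff_add_le]
      exact_mod_cast (by omega : #(L \ S) + k ≤ Fintype.card ι)
    have hnn : 0 ≤ ∑ i ∈ L, x i := sum_nonneg fun i _ => (hx i).le
    have : ∑ i ∈ L ∩ S, ∑ j ∈ L \ S, (x i - x j) =
        #(L \ S) * (∑ i ∈ L ∩ S, x i) - #(L ∩ S) * ∑ j ∈ L \ S, x j := by
      simp only [sum_sub_distrib, sum_const, nsmul_eq_mul, mul_sum]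
    have h' : (#(L \ S) : ℝ) * (∑ i ∈ L ∩ S, x i) - #(L ∩ S) * ∑ j ∈ L \ S, x j =
        #(L \ S) * (∑ i ∈ L, x i) - #L * ∑ j ∈ L \ S, x j := by
      rw [← hsum, ← hcard]; ring
    rw [this, h']
    exact sub_le_sub_right (mul_le_mul_of_nonneg_right hle hnn) _
  have h4 := h2.trans (sum_le_sum h3)
  have h5 : ∑ S ∈ univ.powersetCard k, (∏ a ∈ S, x a) *
        (((Fintype.card ι : ℝ) - k) * (∑ i ∈ L, x i) - #L * ∑ j ∈ L \ S, x j) =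
      ((Fintype.card ι : ℝ) - k) * (∑ i ∈ L, x i) * elemSymm x k -
        #L * ∑ S ∈ univ.powersetCard k, (∏ a ∈ S, x a) * ∑ j ∈ L \ S, x j := by
    generalize ((Fintype.card ι : ℝ) - k) * (∑ i ∈ L, x i) = c
    rw [elemSymm, mul_sum, mul_sum, ← sum_sub_distrib]
    refine sum_congr rfl fun S _ => ?_
    ring
  rw [h5] at h4
  nlinarith [mul_le_mul_of_nonneg_left h1 (Nat.cast_nonneg (α := ℝ) #L)]

omit [DecidableEq ι] in
theorem elemSymm_pos {x : ι → ℝ} (hx : ∀ i, 0 < x i) {k : ℕ} (hk : k ≤ Fintype.card ι) :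
    0 < elemSymm x k :=
  sum_pos (fun _ _ => prod_pos fun i _ => hx i) (powersetCard_nonempty.2 hk)

end ElemSymm

/-! ### Bounds by the tail sum under spectral decay. -/

/-- The sum of the entries of `x` from position `k` on. -/
def tailSum {n : ℕ} (x : Fin n → ℝ) (k : ℕ) : ℝ :=
  ∑ i ∈ Finset.univ.filter (fun i : Fin n => k ≤ (i : ℕ)), x i


open Finset in
/-- If the variables just before and just after position `k` have the same order of magnitude, then
the ratio of consecutive elementary symmetric polynomials is controlled by the tail sum. -/
theorem elemSymm_succ_le_tail {n k d : ℕ} {x : Fin n → ℝ} (hx : ∀ i, 0 < x i) (hk : k < n)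
    (hd : d ≤ k) {c₁ c₂ F : ℝ} (hc₁ : 0 < c₁) (hc₂ : 0 < c₂) (hF : 0 < F)
    (hup : ∀ i : Fin n, k ≤ (i : ℕ) + d → (i : ℕ) < k → x i ≤ 2 * c₂ * F)
    (hlow : ∀ i : Fin n, k ≤ (i : ℕ) → (i : ℕ) < k + d → c₁ * F / 2 ≤ x i) :
    ((d : ℝ) + 1) * elemSymm x (k + 1) ≤
      (1 + 4 * (c₂ / c₁)) * tailSum x k * elemSymm x k := by
  obtain ⟨l, rfl⟩ := Nat.exists_eq_add_of_lt hk
  set T := tailSum x k with hT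
  rw [tailSum] at hT
  have cardge : ∀ a : ℕ, a ≤ k → #{i : Fin (k + l + 1) | a ≤ (i : ℕ)} = k + l + 1 - a := by
    intro a ha
    have : ({i : Fin (k + l + 1) | a ≤ (i : ℕ)} : Finset _) =
        Finset.Ici (⟨a, by omega⟩ : Fin (k + l + 1)) := by
      ext i; simp [Fin.le_def]
    rw [this, Fin.card_Ici]
  -- The tail, of length `n - k = l + 1`, enlarged by the `d` positions before it.
  set L : Finset (Fin (k + l + 1)) := {i | k - d ≤ (i : ℕ)} with hL
  have hLc : #L = d + (l + 1) := by rw [hL, cardge _ (by omega)]; omega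
  have main := elemSymm_succ_le hx L (k := k) (d := d) (by simp [hLc]; omega)
  have hsplit : ∑ i ∈ L, x i ≤ d * (2 * c₂ * F) + T := by
    have hsub : ({i : Fin (k + l + 1) | k ≤ (i : ℕ)} : Finset _) ⊆ L := by
      intro i; simp only [mem_filter, mem_univ, true_and, hL]; omega
    rw [← sum_sdiff hsub, ← hT]
    gcongr
    have hcard : #(L \ univ.filter (fun i : Fin (k + l + 1) => k ≤ (i : ℕ))) = d := by
      rw [card_sdiff_of_subset hsub, hLc, cardge _ le_rfl]; omega
    calc _ ≤ ∑ i ∈ L \ univ.filter (fun i : Fin (k + l + 1) => k ≤ (i : ℕ)), 2 * c₂ * F := by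
          refine sum_le_sum fun i hi => ?_
          simp only [mem_sdiff, mem_filter, mem_univ, true_and, hL] at hi
          exact hup i (by omega) (by omega)
      _ = _ := by rw [sum_const, hcard, nsmul_eq_mul]
  -- The tail may be shorter than `d`, hence the minimum; `hmin` shows that the factor
  -- `(l+1)/(d+l+1)` from averaging over `L` makes up for this.
  have hTlow : (min (l + 1) d : ℕ) * (c₁ * F / 2) ≤ T := by
    have hcard : #{i : Fin (k + l + 1) | k ≤ (i : ℕ) ∧ (i : ℕ) < k + d} = min (l + 1) d := by
      have : ({i : Fin (k + l + 1) | k ≤ (i : ℕ) ∧ (i : ℕ) < k + d} : Finset _).map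
          Fin.valEmbedding = Finset.Ico k (k + min (l + 1) d) := by
        ext a
        simp only [mem_map, mem_filter, mem_univ, true_and, Fin.valEmbedding_apply, mem_Ico]
        constructor
        · rintro ⟨i, h, rfl⟩; omega
        · intro h; exact ⟨⟨a, by omega⟩, by simp; omega, rfl⟩
      rw [← card_map, this, Nat.card_Ico]; omega
    rw [← hcard, ← nsmul_eq_mul, ← sum_const]
    refine (sum_le_sum fun i hi => ?_).trans
      (sum_le_sum_of_subset_of_nonneg (f := x) ?_ fun i _ _ => (hx i).le)
    · simp only [mem_filter, mem_univ, true_and] at hi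
      exact hlow i hi.1 hi.2
    · intro i; simp only [mem_filter, mem_univ, true_and]; exact fun h => h.1
  have hmin : ((l : ℝ) + 1) * d ≤ (d + (l + 1)) * (min (l + 1) d : ℕ) := by
    have : (l + 1) * d ≤ (d + (l + 1)) * min (l + 1) d := by
      rcases le_total (l + 1) d with h | h
      · rw [min_eq_left h]; nlinarith
      · rw [min_eq_right h]; nlinarith
    exact_mod_cast this
  have hT0 : 0 ≤ T := sum_nonneg fun i _ => (hx i).le
  have hwin : ((l : ℝ) + 1) * (d * (2 * c₂ * F)) ≤ (d + (l + 1)) * (4 * (c₂ / c₁) * T) := by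
    calc ((l : ℝ) + 1) * (d * (2 * c₂ * F)) = (((l : ℝ) + 1) * d) * (2 * c₂ * F) := by ring
      _ ≤ ((d + (l + 1)) * (min (l + 1) d : ℕ)) * (2 * c₂ * F) := by gcongr
      _ = (d + (l + 1)) * (4 * (c₂ / c₁) * ((min (l + 1) d : ℕ) * (c₁ * F / 2))) := by
          field_simp; ring
      _ ≤ _ := by gcongr
  have he : 0 < elemSymm x k := elemSymm_pos hx (by simp; omega)
  have hl : (0 : ℝ) < d + (l + 1) := by positivity
  refine le_of_mul_le_mul_left ?_ hl
  have hbound : ((l : ℝ) + 1) * ∑ i ∈ L, x i ≤ (d + (l + 1)) * ((1 + 4 * (c₂ / c₁)) * T) := by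
    have := mul_le_mul_of_nonneg_left hsplit (by positivity : (0 : ℝ) ≤ l + 1)
    nlinarith [mul_nonneg (Nat.cast_nonneg (α := ℝ) d) hT0]
  rw [hLc, Fintype.card_fin] at main
  push_cast at main
  calc _ = ((d : ℝ) + 1) * (d + (l + 1)) * elemSymm x (k + 1) := by ring
    _ ≤ _ := main
    _ = (((l : ℝ) + 1) * ∑ i ∈ L, x i) * elemSymm x k := by ring
    _ ≤ ((d + (l + 1)) * ((1 + 4 * (c₂ / c₁)) * T)) * elemSymm x k := by gcongr
    _ = _ := by ring

theorem elemSymm_ratio_le {n k d : ℕ} {x : Fin n → ℝ} (hx : ∀ i, 0 < x i) (hk : k < n)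
    (hd : d ≤ k) {c₁ c₂ F q : ℝ} (hc₁ : 0 < c₁) (hc : c₁ ≤ c₂) (hF : 0 < F)
    (hq : (k : ℝ) + 1 ≤ 2 * q * (d + 1))
    (hup : ∀ i : Fin n, k ≤ (i : ℕ) + d → (i : ℕ) < k → x i ≤ 2 * c₂ * F)
    (hlow : ∀ i : Fin n, k ≤ (i : ℕ) → (i : ℕ) < k + d → c₁ * F / 2 ≤ x i) :
    ((k : ℝ) + 1) * elemSymm x (k + 1) / elemSymm x k ≤
      10 * (c₂ / c₁) * q * tailSum x k := by
  have h := elemSymm_succ_le_tail hx hk hd hc₁ (hc₁.trans_le hc) hF hup hlow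
  have he : 0 < elemSymm x k := elemSymm_pos hx (by simp; omega)
  have he' : 0 < elemSymm x (k + 1) := elemSymm_pos hx (by simp; omega)
  have hT : 0 ≤ tailSum x k := Finset.sum_nonneg fun i _ => (hx i).le
  set T := tailSum x k
  have hg : 1 ≤ c₂ / c₁ := (one_le_div hc₁).2 hc
  have hq0 : 0 ≤ q := by
    by_contra hneg
    push Not at hneg
    nlinarith [Nat.cast_nonneg (α := ℝ) k, Nat.cast_nonneg (α := ℝ) d]
  rw [div_le_iff₀ he]
  calc ((k : ℝ) + 1) * elemSymm x (k + 1) ≤ 2 * q * (d + 1) * elemSymm x (k + 1) := by gcongr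
    _ = 2 * q * ((d + 1) * elemSymm x (k + 1)) := by ring
    _ ≤ 2 * q * ((1 + 4 * (c₂ / c₁)) * T * elemSymm x k) := by gcongr
    -- As `c₂ / c₁ ≥ 1`, it absorbs the summand 1; the final constant is `10 = 2 * (1 + 4)`.
    _ ≤ 2 * q * ((c₂ / c₁ + 4 * (c₂ / c₁)) * T * elemSymm x k) := by gcongr
    _ = _ := by ring

theorem elemSymm_ratio_le_of_polynomial {n k : ℕ} {x : Fin n → ℝ} (hk : k < n)
    {c₁ c₂ p : ℝ} (hc₁ : 0 < c₁) (hc : c₁ ≤ c₂) (hp : 1 < p)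
    (h : ∀ i : Fin n, c₁ * ((i : ℝ) + 1) ^ (-p) ≤ x i ∧ x i ≤ c₂ * ((i : ℝ) + 1) ^ (-p)) :
    ((k : ℝ) + 1) * elemSymm x (k + 1) / elemSymm x k ≤
      10 * (c₂ / c₁) * p * tailSum x k := by
  have hp0 : 0 < p := by linarith
  have hx : ∀ i, 0 < x i := fun i => lt_of_lt_of_le (by positivity) (h i).1
  set d := ⌊((k : ℝ) + 1) / (2 * p)⌋₊
  have hdle : (d : ℝ) ≤ ((k : ℝ) + 1) / (2 * p) := Nat.floor_le (by positivity)
  have hdlt : ((k : ℝ) + 1) / (2 * p) < d + 1 := Nat.lt_floor_add_one _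
  have hdp : 2 * p * d ≤ (k : ℝ) + 1 := by
    rw [le_div_iff₀ (by positivity)] at hdle; linarith
  have hdk : d ≤ k := by
    have : 2 * d < (k + 1) + 1 := by
      have : 2 * (d : ℝ) < k + 1 + 1 := by nlinarith [Nat.cast_nonneg (α := ℝ) d]
      exact_mod_cast this
    omega
  have hK : (0 : ℝ) < k + 1 := by positivity
  -- Bernoulli's inequality: shrinking the base by the relative amount `1/(2p)` costs the `p`-th
  -- power at most a factor 2. This dictates the choice of `d`.
  have hbern : (1 / 2 : ℝ) ≤ (1 - 1 / (2 * p)) ^ p := by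
    have h1 : 1 / (2 * p) ≤ 1 := by rw [div_le_one (by positivity)]; linarith
    have := one_add_mul_self_le_rpow_one_add (s := -(1 / (2 * p))) (by linarith) hp.le
    have e : 1 + p * -(1 / (2 * p)) = 1 / 2 := by field_simp; ring
    rw [e, ← sub_eq_add_neg] at this
    exact this
  have hq0 : 0 < 1 - 1 / (2 * p) := by
    rw [sub_pos, div_lt_one (by positivity)]; linarith
  have key : ∀ u v : ℝ, 0 < v → (1 - 1 / (2 * p)) * v ≤ u → u ^ (-p) ≤ 2 * v ^ (-p) := by
    intro u v hv huv
    have hu : 0 < u := lt_of_lt_of_le (by positivity) huv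
    have h1 : (1 / 2) * v ^ p ≤ u ^ p := by
      calc (1 / 2) * v ^ p ≤ (1 - 1 / (2 * p)) ^ p * v ^ p := by gcongr
        _ = ((1 - 1 / (2 * p)) * v) ^ p := (Real.mul_rpow hq0.le hv.le).symm
        _ ≤ u ^ p := by gcongr
    rw [Real.rpow_neg hu.le, Real.rpow_neg hv.le, ← div_eq_mul_inv,
      inv_eq_one_div, div_le_div_iff₀ (by positivity) (by positivity)]
    linarith
  have hF : (0 : ℝ) < ((k : ℝ) + 1) ^ (-p) := by positivity
  have hdp' : (d : ℝ) ≤ 1 / (2 * p) * (k + 1) := by rw [one_div_mul_eq_div]; exact hdle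
  refine elemSymm_ratio_le hx hk hdk hc₁ hc hF ?_ ?_ ?_
  · rw [div_lt_iff₀ (by positivity)] at hdlt; nlinarith
  · intro i hi _
    refine (h i).2.trans ?_
    have hi' : (k : ℝ) ≤ i + d := by exact_mod_cast hi
    have := key ((i : ℝ) + 1) (k + 1) hK (by linarith)
    calc c₂ * ((i : ℝ) + 1) ^ (-p) ≤ c₂ * (2 * ((k : ℝ) + 1) ^ (-p)) :=
          mul_le_mul_of_nonneg_left this (hc₁.le.trans hc)
      _ = _ := by ring
  · intro i _ hi
    refine le_trans ?_ (h i).1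
    have hi' : (i : ℝ) + 1 ≤ k + 1 + d := by exact_mod_cast (by omega)
    -- With `t = 1/(2p)`, this is `(1 - t)(1 + t) ≤ 1`.
    have h2 : (1 - 1 / (2 * p)) * ((i : ℝ) + 1) ≤ k + 1 := by
      have h3 : (0 : ℝ) < 1 / (2 * p) := by positivity
      calc (1 - 1 / (2 * p)) * ((i : ℝ) + 1) ≤
            (1 - 1 / (2 * p)) * ((k + 1) + 1 / (2 * p) * (k + 1)) :=
          mul_le_mul_of_nonneg_left (by linarith) hq0.le
        _ = (k + 1) - (1 / (2 * p)) ^ 2 * (k + 1) := by ring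
        _ ≤ k + 1 := by linarith [show 0 ≤ (1 / (2 * p)) ^ 2 * ((k : ℝ) + 1) by positivity]
    have := key (k + 1) ((i : ℝ) + 1) (by positivity) h2
    calc c₁ * ((k : ℝ) + 1) ^ (-p) / 2 ≤ c₁ * (2 * ((i : ℝ) + 1) ^ (-p)) / 2 := by gcongr
      _ = _ := by ring

theorem elemSymm_ratio_le_of_exponential {n k : ℕ} {x : Fin n → ℝ} (hk : k < n)
    {c₁ c₂ δ : ℝ} (hc₁ : 0 < c₁) (hc : c₁ ≤ c₂) (hδ : 0 < δ) (hδ1 : δ < 1)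
    (h : ∀ i : Fin n, c₁ * (1 - δ) ^ ((i : ℕ) + 1) ≤ x i ∧ x i ≤ c₂ * (1 - δ) ^ ((i : ℕ) + 1)) :
    ((k : ℝ) + 1) * elemSymm x (k + 1) / elemSymm x k ≤
      10 * (c₂ / c₁) * (1 + δ * k) * tailSum x k := by
  have hr : 0 < 1 - δ := by linarith
  have hr1 : 1 - δ ≤ 1 := by linarith
  have hx : ∀ i, 0 < x i := fun i => lt_of_lt_of_le (by positivity) (h i).1
  set d := min k ⌊1 / (2 * δ)⌋₊ with hd
  have hdle : (d : ℝ) ≤ 1 / (2 * δ) :=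
    (Nat.cast_le.2 (min_le_right _ _)).trans (Nat.floor_le (by positivity))
  -- Bernoulli again: `(1 - δ)^d ≥ 1 - dδ ≥ 1/2`.
  have hpow : (1 / 2 : ℝ) ≤ (1 - δ) ^ d := by
    have := one_add_mul_le_pow (a := -δ) (by linarith) d
    rw [← sub_eq_add_neg] at this
    refine le_trans ?_ this
    rw [le_div_iff₀ (by positivity)] at hdle
    linarith
  have key : ∀ a b : ℕ, b ≤ a + d → (1 - δ) ^ a ≤ 2 * (1 - δ) ^ b := by
    intro a b hab
    have h1 : (1 - δ) ^ (a + d) ≤ (1 - δ) ^ b := pow_le_pow_of_le_one hr.le hr1 hab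
    rw [pow_add] at h1
    nlinarith [pow_pos hr a]
  have hF : (0 : ℝ) < (1 - δ) ^ (k + 1) := by positivity
  refine elemSymm_ratio_le hx hk (d := d) (min_le_left _ _) hc₁ hc hF ?_ ?_ ?_
  -- Either `d = k` and the claim is immediate, or `1 < 2δ(d+1)`, which yields `k ≤ 2δk(d+1)`.
  · rcases le_total k ⌊1 / (2 * δ)⌋₊ with hle | hle
    · rw [hd, min_eq_left hle]
      nlinarith [mul_nonneg hδ.le (Nat.cast_nonneg (α := ℝ) k), Nat.cast_nonneg (α := ℝ) k,
        mul_nonneg (mul_nonneg hδ.le (Nat.cast_nonneg (α := ℝ) k)) (Nat.cast_nonneg (α := ℝ) k)]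
    · have h1 : 1 / (2 * δ) < d + 1 := by
        rw [hd, min_eq_right hle]; exact Nat.lt_floor_add_one _
      rw [div_lt_iff₀ (by positivity)] at h1
      have h2 : (1 : ℝ) ≤ d + 1 := by linarith [Nat.cast_nonneg (α := ℝ) d]
      nlinarith [mul_le_mul_of_nonneg_left h1.le (Nat.cast_nonneg (α := ℝ) k)]
  · intro i hi _
    refine (h i).2.trans ?_
    calc c₂ * (1 - δ) ^ ((i : ℕ) + 1) ≤ c₂ * (2 * (1 - δ) ^ (k + 1)) :=
          mul_le_mul_of_nonneg_left (key _ _ (by omega)) (hc₁.le.trans hc)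
      _ = _ := by ring
  · intro i _ hi
    refine le_trans ?_ (h i).1
    calc c₁ * (1 - δ) ^ (k + 1) / 2 ≤ c₁ * (2 * (1 - δ) ^ ((i : ℕ) + 1)) / 2 := by
          have := key (k + 1) ((i : ℕ) + 1) (by omega)
          gcongr
      _ = _ := by ring

/-! ### The expected error as a function of the spectrum. -/

variable {m n : ℕ}

/-- Up to sign, the sum of the principal minors of size `k` is a coefficient of the characteristic
polynomial, so the matrix may be replaced by the diagonal one. -/
theorem kDPPNormalizer_eq_of_charpoly_eq {K M : Matrix (Fin n) (Fin n) ℝ}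
    (h : K.charpoly = M.charpoly) {k : ℕ} (hk : k ≤ n) :
    kDPPNormalizer K k = kDPPNormalizer M k := by
  have hK := K.charpoly_coeff_eq_sum_minors k (by simpa using hk)
  rw [h, M.charpoly_coeff_eq_sum_minors k (by simpa using hk)] at hK
  exact (mul_left_cancel₀ (by simp) hK).symm

theorem kDPPNormalizer_diagonal (x : Fin n → ℝ) (k : ℕ) :
    kDPPNormalizer (Matrix.diagonal x) k = elemSymm x k := by
  refine Finset.sum_congr rfl fun S _ => ?_
  rw [principalMinor, Matrix.submatrix_diagonal _ _ Subtype.val_injective, Matrix.det_diagonal]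
  exact Finset.prod_coe_sort S x

theorem gram_charpoly (A : Matrix (Fin m) (Fin n) ℝ) :
    (Aᵀ * A).charpoly = (Matrix.diagonal (gramEigenvalue A)).charpoly := by
  rw [(isHermitian_gram A).charpoly_eq, Matrix.charpoly_diagonal]
  refine Fintype.prod_equiv
    ((Fintype.equivOfCardEq (Fintype.card_fin _)).symm.trans (finCongr (Fintype.card_fin n)))
    _ _ fun i => ?_
  rfl

theorem kDPPNormalizer_gram (A : Matrix (Fin m) (Fin n) ℝ) {k : ℕ} (hk : k ≤ n) :
    kDPPNormalizer (Aᵀ * A) k = elemSymm (gramEigenvalue A) k := by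
  rw [kDPPNormalizer_eq_of_charpoly_eq (gram_charpoly A) hk, kDPPNormalizer_diagonal]

theorem gramEigenvalue_antitone (A : Matrix (Fin m) (Fin n) ℝ) : Antitone (gramEigenvalue A) :=
  fun _ _ h => (isHermitian_gram A).eigenvalues₀_antitone h

theorem posDef_gram_of_gramEigenvalue_pos {A : Matrix (Fin m) (Fin n) ℝ} (h : ∀ i, 0 < gramEigenvalue A i) :
    (Aᵀ * A).PosDef := by
  rw [(isHermitian_gram A).posDef_iff_eigenvalues_pos]
  intro i
  exact h (Fin.cast (Fintype.card_fin n) ((Fintype.equivOfCardEq (Fintype.card_fin _)).symm i))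

/-- The column of `A` with index `j`, as a vector of Euclidean space. -/
abbrev euclCol (A : Matrix (Fin m) (Fin n) ℝ) (j : Fin n) : EuclideanSpace ℝ (Fin m) :=
  WithLp.toLp 2 (A.col j)

theorem inner_euclCol (A : Matrix (Fin m) (Fin n) ℝ) (i j : Fin n) :
    inner ℝ (euclCol A i) (euclCol A j) = (Aᵀ * A) i j := by
  simp [PiLp.inner_apply, Matrix.mul_apply, mul_comm]

theorem Er_eq_sum_norm_sq (A : Matrix (Fin m) (Fin n) ℝ) (S : Finset (Fin n)) :
    Er A S = ∑ j, ‖euclCol A j - (colSpan A S).starProjection (euclCol A j)‖ ^ 2 := by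
  have hproj : ∀ i j, (projMatrix A S * A) i j =
      (colSpan A S).starProjection (euclCol A j) i := by
    intro i j
    have h : Matrix.toEuclideanLin (projMatrix A S) (euclCol A j) =
        (colSpan A S).starProjection (euclCol A j) := by
      rw [projMatrix, LinearEquiv.apply_symm_apply]; rfl
    rw [← h]
    simp [Matrix.toLpLin_apply, Matrix.mul_apply, Matrix.mulVec, dotProduct]
  rw [Er, frobSq, Finset.sum_comm]
  refine Finset.sum_congr rfl fun j _ => ?_
  rw [EuclideanSpace.norm_sq_eq]
  refine Finset.sum_congr rfl fun i _ => ?_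
  rw [Matrix.sub_apply, hproj]
  simp

/-- The Schur complement of the block `S` is `K j j - bᵀ G⁻¹ b`, the squared distance of column `j`
from the span: `y = G⁻¹ b` solves the normal equations. -/
theorem principalMinor_insert {A : Matrix (Fin m) (Fin n) ℝ} (hA : (Aᵀ * A).PosDef)
    {S : Finset (Fin n)} {j : Fin n} (hj : j ∉ S) :
    principalMinor (Aᵀ * A) (insert j S) = principalMinor (Aᵀ * A) S *
      ‖euclCol A j - (colSpan A S).starProjection (euclCol A j)‖ ^ 2 := by
  set K := Aᵀ * A with hK
  have hin : ∀ i j, inner ℝ (euclCol A i) (euclCol A j) = K i j := inner_euclCol A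
  set G : Matrix S S ℝ := K.submatrix Subtype.val Subtype.val with hG
  have hGpos : G.PosDef := hA.submatrix Subtype.val_injective
  have hGdet : IsUnit G.det := hGpos.det_pos.ne'.isUnit
  let _ : Invertible G := Matrix.invertibleOfIsUnitDet G hGdet
  set b : S → ℝ := fun i => K i j with hb
  have hsymm : ∀ i j, K i j = K j i := fun i j => by
    rw [← hin, ← hin, real_inner_comm]
  set y : S → ℝ := G⁻¹ *ᵥ b with hy
  have hGy : G *ᵥ y = b := by
    rw [hy, Matrix.mulVec_mulVec, Matrix.mul_nonsing_inv _ hGdet, Matrix.one_mulVec]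
  set v : EuclideanSpace ℝ (Fin m) := ∑ i : S, y i • euclCol A i with hv
  have horth : ∀ i ∈ S, inner ℝ (euclCol A j - v) (euclCol A i) = 0 := by
    intro i hi
    have := congrFun hGy ⟨i, hi⟩
    rw [inner_sub_left, hin, hv, sum_inner, hsymm, sub_eq_zero]
    simp_rw [real_inner_smul_left, hin]
    rw [hb] at this
    simp only at this
    rw [← this, Matrix.mulVec, dotProduct]
    refine Finset.sum_congr rfl fun a _ => ?_
    rw [hG, Matrix.submatrix_apply, hsymm, mul_comm]
  have hproj : (colSpan A S).starProjection (euclCol A j) = v := by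
    refine Submodule.eq_starProjection_of_mem_of_inner_eq_zero ?_ ?_
    · exact Submodule.sum_mem _ fun i _ => Submodule.smul_mem _ _
        (Submodule.subset_span ⟨i, i.2, rfl⟩)
    · intro w hw
      induction hw using Submodule.span_induction with
      | mem w hw => obtain ⟨i, hi, rfl⟩ := hw; exact horth i hi
      | zero => simp
      | add x z _ _ hx hz => rw [inner_add_right, hx, hz, add_zero]
      | smul a x _ hx => rw [inner_smul_right, hx, mul_zero]
  have hnorm : ‖euclCol A j - v‖ ^ 2 = K j j - b ⬝ᵥ y := by
    have hv0 : inner ℝ (euclCol A j - v) v = 0 := by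
      rw [hv, inner_sum]
      exact Finset.sum_eq_zero fun i _ => by rw [inner_smul_right, horth i i.2, mul_zero]
    rw [← real_inner_self_eq_norm_sq, inner_sub_right, hv0, sub_zero, inner_sub_left,
      hin, hv, sum_inner, dotProduct]
    congr 1
    refine Finset.sum_congr rfl fun i _ => ?_
    rw [real_inner_smul_left, hin, mul_comm]
  have hblock : principalMinor K (insert j S) =
      (Matrix.fromBlocks G (Matrix.replicateCol Unit b) (Matrix.replicateRow Unit b)
        (Matrix.of fun _ _ : Unit => K j j)).det := by
    let e : (insert j S : Finset (Fin n)) ≃ S ⊕ Unit :=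
      (Finset.subtypeInsertEquivOption hj).trans (Equiv.optionEquivSumPUnit S)
    rw [principalMinor, ← Matrix.det_submatrix_equiv_self e.symm]
    congr 1
    ext (a | a) (c | c)
    · rfl
    · rfl
    · exact hsymm _ _
    · rfl
  rw [hblock, Matrix.det_fromBlocks₁₁, hproj, hnorm]
  congr 1
  rw [Matrix.det_unique, Matrix.sub_apply, Matrix.of_apply, Matrix.mul_assoc,
    Matrix.invOf_eq_nonsing_inv]
  rfl

/-- The expected error of `k`-DPP sampling in terms of the spectrum. -/
theorem kDPPExpect_Er {A : Matrix (Fin m) (Fin n) ℝ} (h : ∀ i, 0 < gramEigenvalue A i)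
    {k : ℕ} (hk : k < n) :
    kDPPExpect (Aᵀ * A) k (Er A) =
      ((k : ℝ) + 1) * elemSymm (gramEigenvalue A) (k + 1) / elemSymm (gramEigenvalue A) k := by
  have hA := posDef_gram_of_gramEigenvalue_pos h
  rw [← kDPPNormalizer_gram A hk.le, ← kDPPNormalizer_gram A (Nat.succ_le_of_lt hk), kDPPExpect]
  have hEr : ∀ S, principalMinor (Aᵀ * A) S * Er A S =
      ∑ j ∈ Finset.univ \ S, principalMinor (Aᵀ * A) (insert j S) := by
    intro S
    -- Columns with index in `S` have zero residual.
    rw [Er_eq_sum_norm_sq, ← Finset.sum_sdiff (Finset.subset_univ S), mul_add, Finset.mul_sum,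
      Finset.sum_eq_zero (s := S), mul_zero, add_zero]
    · refine Finset.sum_congr rfl fun j hj => ?_
      rw [principalMinor_insert hA (Finset.mem_sdiff.1 hj).2]
    · intro j hj
      rw [Submodule.starProjection_eq_self_iff.2
        (show euclCol A j ∈ colSpan A S from Submodule.subset_span ⟨j, hj, rfl⟩)]
      simp
  have hsum := sum_powersetCard_insert (principalMinor (Aᵀ * A)) Finset.univ k
  simp_rw [← hEr] at hsum
  have hrhs : ∑ T ∈ Finset.univ.powersetCard (k + 1),
      ((T ∩ Finset.univ).card : ℝ) * principalMinor (Aᵀ * A) T =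
      ((k : ℝ) + 1) * kDPPNormalizer (Aᵀ * A) (k + 1) := by
    rw [kDPPNormalizer, Finset.mul_sum]
    refine Finset.sum_congr rfl fun T hT => ?_
    rw [Finset.inter_univ, Finset.mem_powersetCard_univ.1 hT]
    push_cast
    rfl
  rw [hrhs] at hsum
  rw [← hsum, Finset.sum_div]
  have hfil : Finset.univ.powersetCard k =
      Finset.univ.filter fun S : Finset (Fin n) => S.card = k := by
    ext S; simp
  rw [hfil, Finset.sum_filter]
  refine Finset.sum_congr rfl fun S _ => ?_
  rw [kDPPProb]
  split_ifs
  · ring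
  · simp

/-! ### The Eckart–Young lower bound. -/

/-- Weights in `[0, 1]` of total `n - k` do best on the smallest entries: `x i - x k` and `c i -
1_{i ≥ k}` always have the same sign. -/
theorem tailSum_le_sum_mul {x c : Fin n → ℝ} (hx : Antitone x) {k : ℕ} (hk : k < n)
    (hc0 : ∀ i, 0 ≤ c i) (hc1 : ∀ i, c i ≤ 1) (hc : ∑ i, c i = (n : ℝ) - k) :
    tailSum x k ≤ ∑ i, x i * c i := by
  set a : Fin n → ℝ := fun i => if k ≤ (i : ℕ) then 1 else 0 with ha
  have hcard : ∑ i, a i = (n : ℝ) - k := by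
    have : (Finset.univ.filter fun i : Fin n => k ≤ (i : ℕ)) = Finset.Ici (⟨k, hk⟩ : Fin n) := by
      ext i; simp [Fin.le_def]
    rw [ha, Finset.sum_boole, this, Fin.card_Ici, Nat.cast_sub hk.le]
  have htail : tailSum x k = ∑ i, x i * a i := by
    simp [tailSum, ha, Finset.sum_filter]
  have hterm : ∀ i, 0 ≤ (x i - x ⟨k, hk⟩) * (c i - a i) := by
    intro i
    by_cases h : k ≤ (i : ℕ)
    · have h1 : x i ≤ x ⟨k, hk⟩ := hx h
      have h2 : c i - a i ≤ 0 := by simp [ha, h, hc1 i]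
      exact mul_nonneg_of_nonpos_of_nonpos (sub_nonpos.2 h1) h2
    · have h1 : x ⟨k, hk⟩ ≤ x i := hx (not_le.1 h).le
      have h2 : 0 ≤ c i - a i := by simp [ha, h, hc0 i]
      exact mul_nonneg (sub_nonneg.2 h1) h2
  have hsum := Finset.sum_nonneg fun i (_ : i ∈ Finset.univ) => hterm i
  have hexp : ∑ i, (x i - x ⟨k, hk⟩) * (c i - a i) =
      (∑ i, x i * c i - ∑ i, x i * a i) - x ⟨k, hk⟩ * (∑ i, c i - ∑ i, a i) := by
    rw [← Finset.sum_sub_distrib, ← Finset.sum_sub_distrib, Finset.mul_sum,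
      ← Finset.sum_sub_distrib]
    exact Finset.sum_congr rfl fun i _ => by ring
  rw [hexp, hc, hcard, sub_self, mul_zero, sub_zero, ← htail] at hsum
  linarith

/-- The bijection between the two indexings of the eigenvalues of the Gram matrix. -/
def gramIndexEquiv (n : ℕ) : Fin n ≃ Fin n :=
  (Fintype.equivOfCardEq (Fintype.card_fin _)).symm.trans (finCongr (Fintype.card_fin n))

/-- An orthonormal basis of eigenvectors of the Gram matrix, in the order of `gramEigenvalue`. -/
def gramBasis (A : Matrix (Fin m) (Fin n) ℝ) :
    OrthonormalBasis (Fin n) ℝ (EuclideanSpace ℝ (Fin n)) :=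
  (isHermitian_gram A).eigenvectorBasis.reindex (gramIndexEquiv n)

theorem eigenvalues_gram_eq (A : Matrix (Fin m) (Fin n) ℝ) (i : Fin n) :
    (isHermitian_gram A).eigenvalues i = gramEigenvalue A (gramIndexEquiv n i) := rfl

theorem gram_mulVec_gramBasis (A : Matrix (Fin m) (Fin n) ℝ) (i : Fin n) :
    (Aᵀ * A) *ᵥ (gramBasis A i).ofLp = gramEigenvalue A i • (gramBasis A i).ofLp := by
  obtain ⟨j, rfl⟩ := (gramIndexEquiv n).surjective i
  rw [gramBasis, OrthonormalBasis.reindex_apply, Equiv.symm_apply_apply, ← eigenvalues_gram_eq]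
  exact (isHermitian_gram A).mulVec_eigenvectorBasis j

theorem mulVec_dotProduct_self (A : Matrix (Fin m) (Fin n) ℝ) (w : EuclideanSpace ℝ (Fin n)) :
    (A *ᵥ w.ofLp) ⬝ᵥ (A *ᵥ w.ofLp) =
      ∑ i, gramEigenvalue A i * inner ℝ (gramBasis A i) w ^ 2 := by
  have h1 : (A *ᵥ w.ofLp) ⬝ᵥ (A *ᵥ w.ofLp) =
      inner ℝ (WithLp.toLp 2 ((Aᵀ * A) *ᵥ w.ofLp)) w := by
    rw [EuclideanSpace.inner_eq_star_dotProduct, star_trivial, ← Matrix.mulVec_mulVec,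
      Matrix.dotProduct_mulVec w.ofLp, Matrix.vecMul_transpose]
  rw [h1, ← (gramBasis A).sum_inner_mul_inner]
  refine Finset.sum_congr rfl fun i _ => ?_
  have h2 : inner ℝ (WithLp.toLp 2 ((Aᵀ * A) *ᵥ w.ofLp)) (gramBasis A i) =
      gramEigenvalue A i * inner ℝ (gramBasis A i) w := by
    rw [EuclideanSpace.inner_eq_star_dotProduct, EuclideanSpace.inner_eq_star_dotProduct,
      star_trivial, star_trivial, Matrix.dotProduct_mulVec, ← Matrix.mulVec_transpose,
      Matrix.transpose_mul, Matrix.transpose_transpose, gram_mulVec_gramBasis,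
      smul_dotProduct, smul_eq_mul, dotProduct_comm]
  rw [h2]; ring

/-- Bessel's inequality for each row of `M`. -/
theorem sum_mulVec_dotProduct_self_le_frobSq (M : Matrix (Fin m) (Fin n) ℝ) {ι : Type*}
    [Fintype ι] {w : ι → EuclideanSpace ℝ (Fin n)} (hw : Orthonormal ℝ w) :
    ∑ i, (M *ᵥ (w i).ofLp) ⬝ᵥ (M *ᵥ (w i).ofLp) ≤ frobSq M := by
  simp only [dotProduct]
  rw [Finset.sum_comm, frobSq]
  refine Finset.sum_le_sum fun r _ => ?_
  have h := hw.sum_inner_products_le (WithLp.toLp 2 (M r)) (s := Finset.univ)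
  rw [EuclideanSpace.norm_sq_eq] at h
  simp only [Real.norm_eq_abs, sq_abs] at h
  refine le_trans (le_of_eq (Finset.sum_congr rfl fun i _ => ?_)) h
  rw [← sq, EuclideanSpace.inner_eq_star_dotProduct, star_trivial]
  rfl

/-- The lower bound in the Eckart–Young theorem. -/
theorem tailSum_le_frobSq_sub (A B : Matrix (Fin m) (Fin n) ℝ) {k : ℕ} (hk : k < n)
    (hB : B.rank = k) : tailSum (gramEigenvalue A) k ≤ frobSq (A - B) := by
  -- On the kernel of `B` the matrices `A - B` and `A` agree. An orthonormal basis of it gives each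
  -- `λ_i` a weight that is at most 1 by Bessel; by Parseval the weights add up to `n - k`.
  set e := (WithLp.linearEquiv 2 ℝ (Fin n → ℝ)).symm
  set V := (LinearMap.ker B.mulVecLin).map e.toLinearMap with hV
  have hker : ∀ v ∈ V, B *ᵥ v.ofLp = 0 := by
    rintro _ ⟨v, hv, rfl⟩
    exact hv
  have hdim : (Module.finrank ℝ V : ℝ) = n - k := by
    have h1 : Module.finrank ℝ V = Module.finrank ℝ (LinearMap.ker B.mulVecLin) :=
      e.finrank_map_eq _
    have h2 := B.mulVecLin.finrank_range_add_finrank_ker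
    rw [show Module.finrank ℝ (LinearMap.range B.mulVecLin) = k from hB, ← h1,
      Module.finrank_fin_fun] at h2
    rw [eq_sub_iff_add_eq']
    exact_mod_cast h2
  set b := stdOrthonormalBasis ℝ V
  set w : Fin (Module.finrank ℝ V) → EuclideanSpace ℝ (Fin n) := fun i => b i with hw
  have hwo : Orthonormal ℝ w := b.orthonormal.comp_linearIsometry V.subtypeₗᵢ
  have hfrob := sum_mulVec_dotProduct_self_le_frobSq (A - B) hwo
  have hAw : ∀ i, (A - B) *ᵥ (w i).ofLp = A *ᵥ (w i).ofLp := fun i => by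
    rw [Matrix.sub_mulVec, hker _ (b i).2, sub_zero]
  simp_rw [hAw, mulVec_dotProduct_self] at hfrob
  rw [Finset.sum_comm] at hfrob
  simp_rw [← Finset.mul_sum] at hfrob
  refine le_trans (tailSum_le_sum_mul (gramEigenvalue_antitone A) hk ?_ ?_ ?_) hfrob
  · exact fun i => Finset.sum_nonneg fun j _ => sq_nonneg _
  · intro i
    have h := hwo.sum_inner_products_le (gramBasis A i) (s := Finset.univ)
    rw [(gramBasis A).orthonormal.1 i, one_pow] at h
    simpa only [Real.norm_eq_abs, sq_abs, real_inner_comm] using h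
  · rw [Finset.sum_comm, ← hdim]
    have h : ∀ j, ∑ i, inner ℝ (gramBasis A i) (w j) ^ 2 = 1 := by
      intro j
      have h := (gramBasis A).sum_sq_norm_inner_right (w j)
      rw [hwo.1 j, one_pow] at h
      simpa only [Real.norm_eq_abs, sq_abs] using h
    simp [h]

/-- A real infimum over an empty family is 0, so bounding `OPT` from below requires a competitor. -/
theorem exists_rank_eq {A : Matrix (Fin m) (Fin n) ℝ} (hA : (Aᵀ * A).PosDef) {k : ℕ}
    (hk : k ≤ n) : ∃ B : Matrix (Fin m) (Fin n) ℝ, B.rank = k := by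
  set D : Matrix (Fin n) (Fin n) ℝ := Matrix.diagonal fun i => if (i : ℕ) < k then 1 else 0
    with hD
  have hDr : D.rank = k := by
    rw [hD, Matrix.rank_diagonal, Fintype.card_subtype]
    have : (Finset.univ.filter fun i : Fin n => (if (i : ℕ) < k then (1 : ℝ) else 0) ≠ 0).map
        Fin.valEmbedding = Finset.range k := by
      ext a
      simp only [Finset.mem_map, Finset.mem_filter, Finset.mem_univ, true_and,
        Fin.valEmbedding_apply, Finset.mem_range]
      constructor
      · rintro ⟨i, h, rfl⟩
        simpa using h
      · intro h; exact ⟨⟨a, by omega⟩, by simp [h], rfl⟩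
    rw [← Finset.card_map, this, Finset.card_range]
  -- The rank of `A * D` is at most that of `D`, and at least that of `Aᵀ * A * D`, which is again
  -- `k` because the Gram matrix is invertible.
  refine ⟨A * D, le_antisymm (hDr ▸ Matrix.rank_mul_le_right A D) ?_⟩
  have h := Matrix.rank_mul_eq_right_of_det_ne_zero (Aᵀ * A) D hA.det_pos.ne'
  rw [Matrix.mul_assoc, hDr] at h
  exact h ▸ Matrix.rank_mul_le_right Aᵀ (A * D)

theorem tailSum_le_OPT {A : Matrix (Fin m) (Fin n) ℝ} (h : ∀ i, 0 < gramEigenvalue A i)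
    {k : ℕ} (hk : k < n) : tailSum (gramEigenvalue A) k ≤ OPT A k := by
  obtain ⟨B, hB⟩ := exists_rank_eq (posDef_gram_of_gramEigenvalue_pos h) hk.le
  have : Nonempty {B : Matrix (Fin m) (Fin n) ℝ // B.rank = k} := ⟨⟨B, hB⟩⟩
  exact le_ciInf fun B => tailSum_le_frobSq_sub A B.1 hk B.2

/-! ### From the spectral ratio to the approximation factor. -/

theorem tailSum_pos {x : Fin n → ℝ} (hx : ∀ i, 0 < x i) {k : ℕ} (hk : k < n) :
    0 < tailSum x k :=
  Finset.sum_pos (fun i _ => hx i) ⟨⟨k, hk⟩, by simp⟩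

/-- A bound for the spectral ratio by the tail sum transfers to the approximation factor. -/
theorem approximation_factor_le {A : Matrix (Fin m) (Fin n) ℝ} (h : ∀ i, 0 < gramEigenvalue A i)
    {k : ℕ} (hk : k < n) {C : ℝ} (hC : 0 ≤ C)
    (hratio : ((k : ℝ) + 1) * elemSymm (gramEigenvalue A) (k + 1) /
      elemSymm (gramEigenvalue A) k ≤ C * tailSum (gramEigenvalue A) k) :
    0 < kDPPNormalizer (Aᵀ * A) k ∧ 0 < OPT A k ∧
      kDPPExpect (Aᵀ * A) k (Er A) / OPT A k ≤ C := by
  have hT := tailSum_le_OPT h hk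
  have hO : 0 < OPT A k := (tailSum_pos h hk).trans_le hT
  refine ⟨?_, hO, ?_⟩
  · rw [kDPPNormalizer_gram A hk.le]
    exact elemSymm_pos h (by simpa using hk.le)
  · rw [div_le_iff₀ hO, kDPPExpect_Er h hk]
    exact hratio.trans (mul_le_mul_of_nonneg_left hT hC)

end CSSP

end

theorem theorem2 :
    ∃ c : ℝ, 0 < c ∧
      ∀ (m n : ℕ) (A : Matrix (Fin m) (Fin n) ℝ) (c₁ c₂ : ℝ), 0 < c₁ → c₁ ≤ c₂ →
        (∀ p : ℝ, 1 < p →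
          (∀ i : Fin n,
            c₁ * ((i : ℝ) + 1) ^ (-p) ≤ CSSP.gramEigenvalue A i ∧
              CSSP.gramEigenvalue A i ≤ c₂ * ((i : ℝ) + 1) ^ (-p)) →
          ∀ k : ℕ, k < n →
            0 < CSSP.kDPPNormalizer (Aᵀ * A) k ∧ 0 < CSSP.OPT A k ∧
              CSSP.kDPPExpect (Aᵀ * A) k (CSSP.Er A) / CSSP.OPT A k ≤ c * (c₂ / c₁) * p) ∧
        (∀ δ : ℝ, 0 < δ → δ < 1 →
          (∀ i : Fin n,
            c₁ * (1 - δ) ^ ((i : ℕ) + 1) ≤ CSSP.gramEigenvalue A i ∧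
              CSSP.gramEigenvalue A i ≤ c₂ * (1 - δ) ^ ((i : ℕ) + 1)) →
          ∀ k : ℕ, k < n →
            0 < CSSP.kDPPNormalizer (Aᵀ * A) k ∧ 0 < CSSP.OPT A k ∧
              CSSP.kDPPExpect (Aᵀ * A) k (CSSP.Er A) / CSSP.OPT A k
                ≤ c * (c₂ / c₁) * (1 + δ * (k : ℝ))) := by
  refine ⟨10, by norm_num, fun m n A c₁ c₂ hc₁ hc => ⟨fun p hp h k hk => ?_,
    fun δ hδ hδ1 h k hk => ?_⟩⟩
  · have hc₂ : 0 < c₂ := hc₁.trans_le hc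
    refine CSSP.approximation_factor_le (fun i => lt_of_lt_of_le (by positivity) (h i).1) hk
      (by positivity) (CSSP.elemSymm_ratio_le_of_polynomial hk hc₁ hc hp h)
  · have hc₂ : 0 < c₂ := hc₁.trans_le hc
    have hr : 0 < 1 - δ := by linarith
    refine CSSP.approximation_factor_le (fun i => lt_of_lt_of_le (by positivity) (h i).1) hk
      (by positivity) (CSSP.elemSymm_ratio_le_of_exponential hk hc₁ hc hδ hδ1 h)
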